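/- Let $\Delta$ be a finite reduced crystallographic root system of roots in $\mathfrak h^*$, where $\mathfrak h$ is a finite-dimensional real vector space spanned by the coroots (for instance the root system of a split real semisimple Lie algebra with split Cartan subalgebra $\mathfrak h$). Let $\alpha_1,\dots,\alpha_l$ be simple roots, $\alpha_i^\vee$ the simple coroots, $C_{ij}=\alpha_i(\alpha_j^\vee)$ the Cartan matrix, $s_i$ the simple reflections of $\mathfrak h$ and $W$ the Weyl group they generate. Let $x_0\in\mathfrak h$ satisfy $\alpha_i(x_0)>0$ for all $i$, and let $\Gamma$ be the convex hull of $Wx_0$. For $w\in W$ let $\overline C_w=\{x\in\Gamma:\alpha_i(w^{-1}x)\ge 0\ \forall i\}$; its internal $i$-wall is given by $\alpha_i(w^{-1}x)=0$, and its external $i$-wall by $c_{w,i}(x)=0$, where $x_0-w^{-1}x=\sum_i c_{w,i}(x)\,\alpha_i^\vee$. A marked Dynkin diagram $\delta$ assigns to each ordered pair of joined nodes $i\ne j$ a sign $s_{ij}\in\{\pm1\}$ such that $s_{ij}=s_{ji}$ on single edges and $s_{ij},s_{ji}$ are not both $-1$ on double edges (on triple edges the signs are arbitrary); it is positively marked if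 all these signs are $+1$. Put $\mathcal E=\{\pm1\}^l$ and let $s_i$ act on $\mathcal E$ by $(s_i\epsilon)_j=s_{ij}\epsilon_j$ if $\epsilon_i=-1$ and $j$ is joined to $i$, and $(s_i\epsilon)_j=\epsilon_j$ otherwise. The space $M(\delta)$ is the quotient of the disjoint union of the sets $\{\epsilon\}\times\{w\}\times\overline C_w$ ($\epsilon\in\mathcal E$, $w\in W$) by the gluings $(\epsilon,w,x)\sim(s_i\epsilon,ws_i,x)$ for $x$ on the internal $i$-wall of $\overline C_w$, and $(\epsilon,w,x)\sim(\epsilon^{(i)},w,x)$ for $x$ on the external $i$-wall of $\overline C_w$, where $\epsilon^{(i)}$ is $\epsilon$ with its $i$-th sign reversed. The smooth structure of $M(\delta)$ is the one given by the following parametrizations $\varphi_w$, $w\in W$. For $y\in\mathbb R^l$ put $x_w(y)=w\bigl(x_0-\sum_i y_i^2\alpha_i^\vee\bigr)$; the domain of $\varphi_w$ is the interior of $\{y\in\mathbb R^l: x_w(y)\in\Gamma\}$. If $x_w(y)\in\overline C_w$, then $\varphi_w(y)$ is the class of $(\eta,w,x_w(y))$ with $\eta\in\mathcal E$ and $y_i=\eta_i|y_i|$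 for all $i$; if $x_w(y)\in\overline C_u$ with $u=ws_{i_1}\cdots s_{i_r}$, it is the class of $(s_{i_r}\cdots s_{i_1}\eta,\,u,\,x_w(y))$. A smooth chart is a topological chart $e$ with values in $\mathbb R^l$ such that all $e\circ\varphi_w$ are $C^\infty$ with nonvanishing Jacobian determinant where defined. $M(\delta)$ is orientable if it is covered by a family of smooth charts whose coordinate changes all have positive Jacobian determinant. **Proposition.** If $\delta$ is not positively marked (some sign $s_{ij}$ on an edge is $-1$), then $M(\delta)$ is not orientable. -/

import Mathlib

open scoped ContDiff

noncomputable section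

namespace TwistedTomei

/-! ### Orientability of a smooth structure -/

/-- A smooth structure on `X`, given as the set `S` of all its smooth charts, is orientable if some
family of smooth charts covers `X` and has only coordinate changes of positive Jacobian
determinant. -/
def IsOrientable {X F : Type*} [TopologicalSpace X] [NormedAddCommGroup F] [NormedSpace ℝ F]
    (S : Set (OpenPartialHomeomorph X F)) : Prop :=
  ∃ A : Set (OpenPartialHomeomorph X F), A ⊆ S ∧
    (∀ p : X, ∃ e ∈ A, p ∈ e.source) ∧
    ∀ e ∈ A, ∀ e' ∈ A, ∀ y ∈ (e.symm.trans e').source,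
      0 < (fderiv ℝ (e.symm.trans e') y).det

/-! ### Root data: Weyl group, polytope, chambers

The space `N` plays the role of the split Cartan subalgebra `𝔥`; the roots are functionals on it. -/

variable {ι M N : Type*} [AddCommGroup M] [Module ℝ M] [NormedAddCommGroup N] [NormedSpace ℝ N]
  {P : RootPairing ι ℝ M N}

/-- The Weyl group acting on `𝔥`, generated by the simple reflections. -/
def Weyl (b : P.Base) : Subgroup (N ≃ₗ[ℝ] N) :=
  Subgroup.closure (Set.range fun i : b.support => P.coreflection i)

/-- The simple reflection `s_{α_i}` as an element of the Weyl group. -/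
def simpleReflection (b : P.Base) (i : b.support) : Weyl b :=
  ⟨P.coreflection i, Subgroup.subset_closure ⟨i, rfl⟩⟩

/-- The polytope `Γ`: the convex hull of the Weyl group orbit of `x₀`. -/
def polytope (b : P.Base) (x₀ : N) : Set N :=
  convexHull ℝ (Set.range fun w : Weyl b => (w : N ≃ₗ[ℝ] N) x₀)

/-- The closed chamber of `Γ` indexed by `w`: the intersection of `Γ` with the `w`-translate of the
closed dominant Weyl chamber. -/
def chamber (b : P.Base) (x₀ : N) (w : Weyl b) : Set N :=
  {x | x ∈ polytope b x₀ ∧ ∀ i : b.support, 0 ≤ P.root' i ((w : N ≃ₗ[ℝ] N).symm x)}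

/-- The internal `α_i`-wall of the chamber `w`. -/
def innerWall (b : P.Base) (x₀ : N) (w : Weyl b) (i : b.support) : Set N :=
  {x | x ∈ chamber b x₀ w ∧ P.root' i ((w : N ≃ₗ[ℝ] N).symm x) = 0}

/-- The value at `x₀ - w⁻¹ x` of the `i`-th fundamental weight, i.e. the coefficient of the simple
coroot `α_i^∨`. It is nonnegative on `Γ` and cuts out the facet of `Γ` through `w x₀` which is
perpendicular to the `w`-translate of that fundamental weight. -/
def facetCoord (b : P.Base) [P.IsRootSystem] (x₀ : N) (w : Weyl b) (i : b.support) (x : N) : ℝ :=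
  b.toCoweightBasis.repr (x₀ - (w : N ≃ₗ[ℝ] N).symm x) i

/-- The external `α_i`-wall of the chamber `w`: the part in the chamber of the facet of `Γ` that
meets the internal `α_j`-walls of the chamber for `j ≠ i`, and not the internal `α_i`-wall. -/
def outerWall (b : P.Base) [P.IsRootSystem] (x₀ : N) (w : Weyl b) (i : b.support) : Set N :=
  {x | x ∈ chamber b x₀ w ∧ facetCoord b x₀ w i x = 0}

/-! ### Signs and marked Dynkin diagrams -/

/-- The sign vectors `ε = (ε_1, …, ε_l)`. -/
abbrev Signs (b : P.Base) : Type _ := b.support → ℤˣ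

open Classical in
/-- The sign vector `ε^{(i)}`, with the `i`-th sign reversed. -/
def flipSign {b : P.Base} (i : b.support) (ε : Signs b) : Signs b :=
  fun j => if j = i then -ε j else ε j

/-- A marked Dynkin diagram. The product `C_{ij} C_{ji}` of Cartan integers is the number of lines
joining two distinct nodes: a single edge carries one sign (`s_{ij} = s_{ji}`), a double edge the
pair `+,+` or `±,∓`, and a triple edge any pair of signs. Pairs of nodes that are not joined carry
no sign; there the function `sign` has the value `1`. -/
structure MarkedDynkinDiagram (b : P.Base) [P.IsCrystallographic] where
  /-- The sign `s_{ij}`. -/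
  sign : b.support → b.support → ℤˣ
  sign_self : ∀ i, sign i i = 1
  sign_not_joined : ∀ i j, b.cartanMatrix i j * b.cartanMatrix j i = 0 → sign i j = 1
  sign_single : ∀ i j, b.cartanMatrix i j * b.cartanMatrix j i = 1 → sign i j = sign j i
  sign_double : ∀ i j, b.cartanMatrix i j * b.cartanMatrix j i = 2 → sign i j = 1 ∨ sign j i = 1

/-- All signs over the edges are positive. -/
def MarkedDynkinDiagram.IsPositive {b : P.Base} [P.IsCrystallographic]
    (δ : MarkedDynkinDiagram b) : Prop :=
  ∀ i j : b.support, i ≠ j → b.cartanMatrix i j ≠ 0 → δ.sign i j = 1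

/-- The twisted sign action of the simple reflection `s_{α_i}`: it replaces `ε_j` by
`ε_j ε_i^{a_{ji}}`, where `(-1)^{a_{ji}} = s_{ij}`. -/
def MarkedDynkinDiagram.act {b : P.Base} [P.IsCrystallographic]
    (δ : MarkedDynkinDiagram b) (i : b.support) (ε : Signs b) : Signs b :=
  fun j => if ε i = -1 then ε j * δ.sign i j else ε j

/-! ### The twisted Tomei manifold -/

section Manifold

variable {b : P.Base} [P.IsRootSystem] [P.IsCrystallographic]

/-- The disjoint union of the closed chambers, one copy for each sign vector. -/
abbrev Pieces (b : P.Base) (x₀ : N) : Type _ :=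
  Σ q : Signs b × Weyl b, chamber b x₀ q.2

/-- The gluing maps along the internal walls, `(ε, w, x) ↦ (s_{α_i} ε, w s_{α_i}, x)`, and along
the external walls, `(ε, w, x) ↦ (ε^{(i)}, w, x)`. -/
inductive Glue (δ : MarkedDynkinDiagram b) (x₀ : N) : Pieces b x₀ → Pieces b x₀ → Prop
  | inner (ε : Signs b) (w : Weyl b) (i : b.support) (x : N) (hx : x ∈ chamber b x₀ w)
      (hx' : x ∈ chamber b x₀ (w * simpleReflection b i)) (hwall : x ∈ innerWall b x₀ w i) :
      Glue δ x₀ ⟨(ε, w), x, hx⟩ ⟨(δ.act i ε, w * simpleReflection b i), x, hx'⟩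
  | outer (ε : Signs b) (w : Weyl b) (i : b.support) (x : N) (hx : x ∈ chamber b x₀ w)
      (hwall : x ∈ outerWall b x₀ w i) :
      Glue δ x₀ ⟨(ε, w), x, hx⟩ ⟨(flipSign i ε, w), x, hx⟩

/-- The space `M(δ)`: the quotient of the disjoint union of the chambers by the equivalence relation
generated by the gluing maps, with the quotient topology. -/
def Space (δ : MarkedDynkinDiagram b) (x₀ : N) : Type _ := Quot (Glue δ x₀)

instance (δ : MarkedDynkinDiagram b) (x₀ : N) : TopologicalSpace (Space δ x₀) :=
  inferInstanceAs (TopologicalSpace (Quot (Glue δ x₀)))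

/-- The quotient map `z` from the disjoint union of the chambers. -/
def proj (δ : MarkedDynkinDiagram b) (x₀ : N) : Pieces b x₀ → Space δ x₀ := Quot.mk _

/-- The signed chambers `(ε, w)` and `(ε', w')` are joined by crossing internal walls, each crossing
being `(ε, w) ↦ (s_{α_i} ε, w s_{α_i})`. When the maps `s_{α_i}` define an action of the Weyl group
on the sign vectors, this says `w ε = w' ε'`: the two signed chambers lie in the same copy
`Γ_{wε}(δ)` of the polytope `Γ`. -/
def SameSheet (δ : MarkedDynkinDiagram b) : Signs b × Weyl b → Signs b × Weyl b → Prop :=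
  Relation.ReflTransGen fun p q =>
    ∃ i : b.support, q = (δ.act i p.1, p.2 * simpleReflection b i)

/-! The smooth structure. The copies `{ε} × C_w` of the chamber `w`, glued along their external
walls, form a box around `w x₀`. The coordinates of its point `(ε, w, x)` are
`y_i = ε_i √(facetCoord i x)`, so that the external walls are the coordinate hyperplanes and the
sign vector is that of `y`. These coordinates are continued across the internal walls, along the
copies of `Γ`. -/

/-- The point of `𝔥` with box coordinates `y` at `w`: its facet coordinates are `y_i ^ 2`. -/
def boxPoint (b : P.Base) (x₀ : N) (w : Weyl b) (y : b.support → ℝ) : N :=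
  (w : N ≃ₗ[ℝ] N) (x₀ - ∑ i : b.support, y i ^ 2 • P.coroot i)

/-- The open domain of the box coordinates at `w`. -/
def boxDomain (b : P.Base) (x₀ : N) (w : Weyl b) : Set (b.support → ℝ) :=
  interior {y | boxPoint b x₀ w y ∈ polytope b x₀}

/-- `φ` is the parametrization of a neighbourhood of the box at `w` by its box coordinates: `φ y`
is the point over `boxPoint y` in the copy of `Γ` that has, in the chamber `w`, the signs of `y`. -/
def IsBoxParametrization (δ : MarkedDynkinDiagram b) (x₀ : N) (w : Weyl b)
    (φ : (b.support → ℝ) → Space δ x₀) : Prop :=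
  ∀ y ∈ boxDomain b x₀ w, ∃ (η ε : Signs b) (u : Weyl b) (hx : boxPoint b x₀ w y ∈ chamber b x₀ u),
    (∀ i, y i = ((η i : ℤ) : ℝ) * |y i|) ∧ SameSheet δ (η, w) (ε, u) ∧
      φ y = proj δ x₀ ⟨(ε, u), boxPoint b x₀ w y, hx⟩

/-- The smooth charts of `M(δ)`: the topological charts in which all the box parametrizations are
smooth with invertible derivative. -/
def smoothCharts (δ : MarkedDynkinDiagram b) (x₀ : N) :
    Set (OpenPartialHomeomorph (Space δ x₀) (b.support → ℝ)) :=
  {e | ∀ (w : Weyl b) (φ : (b.support → ℝ) → Space δ x₀), IsBoxParametrization δ x₀ w φ →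
    ContDiffOn ℝ ∞ (e ∘ φ) (boxDomain b x₀ w ∩ φ ⁻¹' e.source) ∧
    ∀ y ∈ boxDomain b x₀ w ∩ φ ⁻¹' e.source, (fderiv ℝ (e ∘ φ) y).det ≠ 0}

end Manifold

end TwistedTomei

end

/-! The space is non-orientable because a loop over one edge of the polytope reverses orientation.
Suppose `∏ k, δ.sign i k = -1` for some node `i`. In the boxes at `1` and at `s_i`, take the segment
of the `i`-th coordinate axis between the two points lying over the midpoint of the edge from `x₀`
to `s_i x₀`. The two segments have the same endpoints in `M(δ)`, so together they form a closed
loop. On the edge the two systems of coordinates are related by `y_i ^ 2 ↦ α_i(x₀) - y_i ^ 2`, so at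
either midpoint the coordinate change has derivative `-1` in direction `i`. In another direction `k`
its derivative is `1` where `y_i > 0` and the sign `s_{ik}` where `y_i < 0`. The Jacobian
determinant is therefore `-1` at one midpoint and `-∏ s_{ik} = 1` at the other
(`det_fderiv_edgeTransition`). An oriented family of charts induces a constant orientation along
each segment (`det_fderiv_mul_pos_of_isPreconnected`), which would force the two determinants to
have the same sign.

Such a node exists by positive definiteness (`exists_prod_sign_eq_neg_one`). Otherwise every row of
signs has an even number of entries `-1`, so each node with a negative sign has at least two. The
negative edges are then too many for a Dynkin diagram: a vector supported on them has nonpositive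
norm. -/

noncomputable section

namespace TwistedTomei

section SignCombinatorics

/-! ### Combinatorics of the signs -/

/-- If every row of a sign matrix has product `1`, then the normalized quadratic form of a Dynkin
diagram carrying these signs is nonpositive on a vector supported on the negative edges. -/
lemma exists_quadratic_nonpos {I : Type*} [Fintype I] (n : I → I → ℝ) (s : I → I → ℤˣ)
    (hdiag : ∀ i, n i i = 1) (hoff : ∀ i j, i ≠ j → n i j ≤ 0)
    (hs : ∀ i j, s i j = -1 → i ≠ j ∧ n i j ≤ -(1 / 2))
    (hs' : ∀ i j, s i j = -1 → s j i = 1 → n i j ≤ -(√2 / 2) ∧ n j i ≤ -(√2 / 2))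
    (hrow : ∀ i, ∏ k, s i k = 1) :
    ∃ c : I → ℝ, (∀ i j, s i j = -1 → c i = 1) ∧ ∑ i, ∑ j, c i * c j * n i j ≤ 0 := by
  classical
  have h2 : √2 * √2 = 2 := Real.mul_self_sqrt (by norm_num)
  have h2pos : 0 < √2 := by positivity
  -- The weights make every negative sign `s i j` contribute at most `-1/2` to row `i`. A node `j`
  -- of weight `√2 / 2` has no negative sign of its own, so `s j i = 1` and the stronger bound `-(√2
  -- / 2)` on `n i j` compensates for the smaller weight.
  set c : I → ℝ := fun i => if ∃ j, s i j = -1 then 1 else if ∃ j, s j i = -1 then √2 / 2 else 0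
    with hc
  have hout : ∀ i j, s i j = -1 → c i = 1 := fun i j h => by simp only [hc]; rw [if_pos ⟨j, h⟩]
  have hin : ∀ i j, s j i = -1 → (¬ ∃ j, s i j = -1) → c i = √2 / 2 := fun i j h h' => by
    simp only [hc]; rw [if_neg h', if_pos ⟨j, h⟩]
  have hc0 : ∀ i, 0 ≤ c i := fun i => by
    simp only [hc]; split_ifs <;> positivity
  have hsign : ∀ i, (¬ ∃ j, s i j = -1) → ∀ j, s i j = 1 := fun i h j =>
    (Int.units_eq_one_or (s i j)).resolve_right fun h' => h ⟨j, h'⟩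
  have hterm : ∀ i j, i ≠ j → c j * n i j ≤ 0 := fun i j hij =>
    mul_nonpos_of_nonneg_of_nonpos (hc0 j) (hoff i j hij)
  have hedge : ∀ i j, s i j = -1 → c j * n i j ≤ -(1 / 2) := fun i j h => by
    by_cases hj : ∃ k, s j k = -1
    · obtain ⟨k, hk⟩ := hj
      rw [hout j k hk, one_mul]
      exact (hs i j h).2
    · rw [hin j i h hj]
      have := (hs' i j h (hsign j hj i)).1
      nlinarith
  refine ⟨c, hout, Finset.sum_nonpos fun i _ => ?_⟩
  simp only [mul_assoc]
  rw [← Finset.mul_sum]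
  by_cases hi : ∃ j, s i j = -1
  · refine mul_nonpos_of_nonneg_of_nonpos (hc0 i) ?_
    obtain ⟨j, hj⟩ := hi
    -- A row with product `1` has an even number of negative signs; two of them already cancel the
    -- diagonal entry `1`.
    obtain ⟨k, hkj, hk⟩ : ∃ k, k ≠ j ∧ s i k = -1 := by
      by_contra! hcon
      have := hrow i
      rw [Finset.prod_eq_single j (fun k _ hk =>
        (Int.units_eq_one_or _).resolve_right (hcon k hk)) (by simp), hj] at this
      exact absurd this (by decide)
    have hij := (hs i j hj).1
    have hik := (hs i k hk).1
    have hsum : ∑ l, c l * n i l ≤ ∑ l ∈ {i, j, k}, c l * n i l :=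
      Finset.sum_le_sum_of_subset_of_nonpos' (Finset.subset_univ _) fun l _ hl =>
        hterm i l fun h => hl (by simp [h])
    rw [Finset.sum_insert (by simp [hij, hik]), Finset.sum_pair hkj.symm, hdiag,
      hout i j hj] at hsum
    linarith [hedge i j hj, hedge i k hk]
  · by_cases hi' : ∃ j, s j i = -1
    · refine mul_nonpos_of_nonneg_of_nonpos (hc0 i) ?_
      obtain ⟨j, hj⟩ := hi'
      have hij := (hs j i hj).1.symm
      have hsum : ∑ l, c l * n i l ≤ ∑ l ∈ {i, j}, c l * n i l :=
        Finset.sum_le_sum_of_subset_of_nonpos' (Finset.subset_univ _) fun l _ hl =>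
          hterm i l fun h => hl (by simp [h])
      rw [Finset.sum_pair hij, hdiag, hout j i hj, hin i j hj hi] at hsum
      linarith [(hs' j i hj (hsign i hi j)).2]
    · have : c i = 0 := by simp only [hc]; rw [if_neg hi, if_neg hi']
      simp [this]

variable {ι M N : Type*} [AddCommGroup M] [Module ℝ M] [NormedAddCommGroup N] [NormedSpace ℝ N]
  {P : RootPairing ι ℝ M N}

/-- The inner products of the normalized simple roots form a positive definite matrix; its square
is a quarter of the product of the Cartan integers. -/
lemma exists_normalized_gram [Finite ι] [P.IsRootSystem] [P.IsCrystallographic] (b : P.Base) :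
    ∃ n : b.support → b.support → ℝ, (∀ i, n i i = 1) ∧ (∀ i j, i ≠ j → n i j ≤ 0) ∧
      (∀ i j, 4 * n i j ^ 2 = ((b.cartanMatrix i j * b.cartanMatrix j i : ℤ) : ℝ)) ∧
      ∀ c : b.support → ℝ, c ≠ 0 → 0 < ∑ i, ∑ j, c i * c j * n i j := by
  have _i : Fintype ι := Fintype.ofFinite ι
  set B := P.posRootForm ℝ
  set D : b.support → ℝ := fun i => B.form (P.root i) (P.root i) with hD
  have hDpos : ∀ i, 0 < D i := fun i => by
    obtain ⟨s, hs, h⟩ := B.exists_pos_eq i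
    simpa [hD, ← h] using hs
  have hC : ∀ i j : b.support, 2 * B.form (P.root i) (P.root j) = b.cartanMatrix i j * D j :=
    fun i j => by
      rw [B.two_mul_apply_root_root]
      congr 1
      exact (b.algebraMap_cartanMatrixIn_apply ℤ i j).symm
  have hsymm : ∀ i j : b.support, B.form (P.root i) (P.root j) = B.form (P.root j) (P.root i) :=
    fun i j => by simpa using B.symm.eq (P.root i) (P.root j)
  have hsq : ∀ i, √(D i) * √(D i) = D i := fun i => Real.mul_self_sqrt (hDpos i).le
  have hsqpos : ∀ i, 0 < √(D i) := fun i => Real.sqrt_pos.2 (hDpos i)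
  refine ⟨fun i j => B.form (P.root i) (P.root j) / (√(D i) * √(D j)), fun i => ?_,
    fun i j hij => ?_, fun i j => ?_, fun c hc => ?_⟩
  · simp only
    rw [hsq]
    exact div_self (hDpos i).ne'
  · refine div_nonpos_of_nonpos_of_nonneg ?_ (mul_pos (hsqpos i) (hsqpos j)).le
    have h1 : (b.cartanMatrix i j : ℝ) ≤ 0 := by exact_mod_cast b.cartanMatrix_le_zero_of_ne i j hij
    nlinarith [hC i j, hDpos j]
  · have h1 := hC i j
    have h2 := hC j i
    rw [hsymm j i] at h2
    rw [div_pow, mul_pow, sq √(D i), sq √(D j), hsq, hsq]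
    have := (hDpos i).ne'
    have := (hDpos j).ne'
    field_simp
    push_cast
    linear_combination 2 * (B.form (P.root i)) (P.root j) * h1 + (b.cartanMatrix i j : ℝ) * D j * h2
  -- The quadratic form at `c` is the invariant form at the combination of the simple roots, each
  -- scaled to length `1`, with coefficients `c i`.
  · set u : P.rootSpan ℝ := ∑ i : b.support, (c i / √(D i)) • P.rootSpanMem ℝ i with hu
    have hu0 : u ≠ 0 := by
      intro h
      have h' : ∑ i : b.support, (c i / √(D i)) • P.root i = 0 := by
        simpa [hu] using congrArg Subtype.val h
      have hli := b.toWeightBasis.linearIndependent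
      rw [Fintype.linearIndependent_iff] at hli
      refine hc (funext fun i => ?_)
      have := hli (fun i => c i / √(D i)) (by simpa using h') i
      simpa [(hsqpos i).ne'] using this
    have hpos := P.posRootForm_posForm_pos_of_ne_zero ℝ hu0
    have heq : B.posForm u u = B.form u u := B.algebraMap_posForm (x := u) (y := u)
    rw [heq] at hpos
    have hcoe : (u : M) = ∑ i : b.support, (c i / √(D i)) • P.root i := by simp [hu]
    rw [hcoe] at hpos
    refine lt_of_lt_of_eq hpos ?_
    simp only [map_sum, LinearMap.sum_apply]
    rw [Finset.sum_comm]
    refine Finset.sum_congr rfl fun i _ => Finset.sum_congr rfl fun j _ => ?_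
    simp only [map_smul, LinearMap.smul_apply, smul_eq_mul]
    rw [hsymm]
    ring

/-- A negative sign requires joined nodes, whence `n i j ≤ -1/2`. If the opposite sign is positive,
the edge is not single, whence `n i j ≤ -(√2 / 2)`. With all row products equal to `1`,
`exists_quadratic_nonpos` would contradict positive definiteness. -/
lemma MarkedDynkinDiagram.exists_prod_sign_eq_neg_one [Finite ι] [P.IsRootSystem]
    [P.IsCrystallographic] {b : P.Base} (δ : MarkedDynkinDiagram b) (hδ : ¬ δ.IsPositive) :
    ∃ i, ∏ k, δ.sign i k = -1 := by
  obtain ⟨n, hdiag, hoff, hsq, hpos⟩ := exists_normalized_gram b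
  by_contra! hcon
  have hrow : ∀ i, ∏ k, δ.sign i k = 1 := fun i => (Int.units_eq_one_or _).resolve_right (hcon i)
  have hprod : ∀ i j, i ≠ j → 0 ≤ b.cartanMatrix i j * b.cartanMatrix j i := fun i j hij =>
    mul_nonneg_of_nonpos_of_nonpos (b.cartanMatrix_le_zero_of_ne i j hij)
      (b.cartanMatrix_le_zero_of_ne j i hij.symm)
  have hne : ∀ i j, δ.sign i j = -1 → i ≠ j := by
    rintro i _ h rfl
    rw [δ.sign_self] at h
    exact absurd h (by decide)
  have hjoin : ∀ i j, δ.sign i j = -1 → 1 ≤ b.cartanMatrix i j * b.cartanMatrix j i := by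
    intro i j h
    have h0 : b.cartanMatrix i j * b.cartanMatrix j i ≠ 0 := fun h0 => by
      rw [δ.sign_not_joined i j h0] at h
      exact absurd h (by decide)
    have := hprod i j (hne i j h)
    omega
  have hmulti : ∀ i j, δ.sign i j = -1 → δ.sign j i = 1 →
      2 ≤ b.cartanMatrix i j * b.cartanMatrix j i := by
    intro i j h h'
    have h1 : b.cartanMatrix i j * b.cartanMatrix j i ≠ 1 := fun h1 => by
      rw [δ.sign_single i j h1, h'] at h
      exact absurd h (by decide)
    have := hjoin i j h
    omega
  have h2 : √2 * √2 = 2 := Real.mul_self_sqrt (by norm_num)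
  have h2pos : 0 < √2 := by positivity
  have hbound : ∀ i j, i ≠ j → 2 ≤ b.cartanMatrix i j * b.cartanMatrix j i → n i j ≤ -(√2 / 2) := by
    intro i j hij h
    have h' : (2 : ℝ) ≤ ((b.cartanMatrix i j * b.cartanMatrix j i : ℤ) : ℝ) := by exact_mod_cast h
    rw [← hsq] at h'
    nlinarith [hoff i j hij]
  obtain ⟨c, hc, hle⟩ := exists_quadratic_nonpos n δ.sign hdiag hoff
    (fun i j h => ⟨hne i j h, by
      have h' : (1 : ℝ) ≤ ((b.cartanMatrix i j * b.cartanMatrix j i : ℤ) : ℝ) := by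
        exact_mod_cast hjoin i j h
      rw [← hsq] at h'
      nlinarith [hoff i j (hne i j h)]⟩)
    (fun i j h h' => ⟨hbound i j (hne i j h) (hmulti i j h h'),
      hbound j i (hne i j h).symm (by rw [mul_comm]; exact hmulti i j h h')⟩) hrow
  simp only [MarkedDynkinDiagram.IsPositive, not_forall] at hδ
  obtain ⟨i, j, -, -, hij⟩ := hδ
  have hi := hc i j ((Int.units_eq_one_or _).resolve_left hij)
  refine absurd (hpos c fun h => ?_) hle.not_gt
  rw [h] at hi
  exact zero_ne_one hi

end SignCombinatorics

section WeylGroup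

variable {ι M N : Type*} [AddCommGroup M] [Module ℝ M] [NormedAddCommGroup N] [NormedSpace ℝ N]
  {P : RootPairing ι ℝ M N}

/-! ### Weyl group and chambers -/

lemma simpleReflection_mul_self (b : P.Base) (i : b.support) :
    simpleReflection b i * simpleReflection b i = 1 := by
  ext x
  simp [simpleReflection]

lemma mul_simpleReflection_symm_apply {b : P.Base} (w : Weyl b) (i : b.support) (x : N) :
    ((w * simpleReflection b i : Weyl b) : N ≃ₗ[ℝ] N).symm x =
      P.coreflection i ((w : N ≃ₗ[ℝ] N).symm x) := by
  rw [LinearEquiv.symm_apply_eq]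
  simp [simpleReflection]

lemma mul_simpleReflection_apply {b : P.Base} (w : Weyl b) (i : b.support) (x : N) :
    ((w * simpleReflection b i : Weyl b) : N ≃ₗ[ℝ] N) x =
      (w : N ≃ₗ[ℝ] N) (P.coreflection i x) := by
  simp [simpleReflection]

/-- Weyl group elements permute the finitely many coroots and, since the simple coroots form a
basis, are determined by this permutation. -/
instance finite_weyl [Finite ι] [P.IsRootSystem] (b : P.Base) : Finite (Weyl b) := by
  have hmaps : ∀ w : Weyl b, ∀ i, (w : N ≃ₗ[ℝ] N) (P.coroot i) ∈ Set.range P.coroot := by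
    rintro ⟨w, hw⟩
    induction hw using Subgroup.closure_induction'' with
    | mem w hw =>
      obtain ⟨j, rfl⟩ := hw
      exact fun i => P.mapsTo_coreflection_coroot j ⟨i, rfl⟩
    | inv_mem w hw =>
      obtain ⟨j, rfl⟩ := hw
      intro i
      simpa using P.mapsTo_coreflection_coroot j ⟨i, rfl⟩
    | one => exact fun i => ⟨i, rfl⟩
    | mul w₁ w₂ _ _ h₁ h₂ =>
      intro i
      obtain ⟨j, hj⟩ := h₂ i
      obtain ⟨k, hk⟩ := h₁ j
      refine ⟨k, ?_⟩
      simp only at hj hk ⊢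
      rw [hk, hj, LinearEquiv.mul_apply]
  have _f : Finite (Set.range P.coroot) := (Set.finite_range _).to_subtype
  refine Finite.of_injective
    (fun (w : Weyl b) (i : ι) => (⟨_, hmaps w i⟩ : Set.range P.coroot)) fun w₁ w₂ h => ?_
  refine Subtype.ext (LinearEquiv.toLinearMap_injective (b.toCoweightBasis.ext fun i => ?_))
  simpa using congrArg Subtype.val (congrFun h i)

/-- Choose `u` maximizing the height `f` of `u⁻¹ x`, the sum of its coefficients in the simple
coroots. Replacing `u` by `u s_i` lowers the height by `α_i(u⁻¹ x)`, which is therefore nonnegative.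
-/
lemma exists_forall_root'_nonneg [Finite ι] [P.IsRootSystem] (b : P.Base) (x : N) :
    ∃ u : Weyl b, ∀ i : b.support, 0 ≤ P.root' i ((u : N ≃ₗ[ℝ] N).symm x) := by
  set f : N →ₗ[ℝ] ℝ := b.toCoweightBasis.constr ℝ fun _ => (1 : ℝ)
  have hf : ∀ i : b.support, f (P.coroot i) = 1 := fun i => by
    rw [← b.toCoweightBasis_apply, Module.Basis.constr_basis]
  obtain ⟨u, hu⟩ := Finite.exists_max fun u : Weyl b => f ((u : N ≃ₗ[ℝ] N).symm x)
  refine ⟨u, fun i => ?_⟩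
  have := hu (u * simpleReflection b i)
  rw [mul_simpleReflection_symm_apply, P.coreflection_apply, map_sub, map_smul, hf] at this
  simpa using this

variable {b : P.Base} [P.IsCrystallographic]

lemma exists_sameSheet (δ : MarkedDynkinDiagram b) (η : Signs b) (w u : Weyl b) :
    ∃ ε, SameSheet δ (η, w) (ε, u) := by
  -- All starting chambers and signs are treated at once: in a product, the walk for the second
  -- factor starts where the first one ends.
  have key : ∀ (g : N ≃ₗ[ℝ] N) (hg : g ∈ Weyl b), ∀ (w : Weyl b) (η : Signs b),
      ∃ ε, SameSheet δ (η, w) (ε, w * ⟨g, hg⟩) := by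
    intro g hg
    have hstep : ∀ (i : b.support) (w : Weyl b) (η : Signs b),
        ∃ ε, SameSheet δ (η, w) (ε, w * simpleReflection b i) := fun i w η =>
      ⟨_, Relation.ReflTransGen.single ⟨i, rfl⟩⟩
    induction hg using Subgroup.closure_induction'' with
    | mem g hg =>
      obtain ⟨i, rfl⟩ := hg
      exact hstep i
    | inv_mem g hg =>
      obtain ⟨i, rfl⟩ := hg
      intro w η
      obtain ⟨ε, h⟩ := hstep i w η
      refine ⟨ε, ?_⟩
      convert h using 4
      exact Subtype.ext (P.coreflection_inv i)
    | one => exact fun w η => ⟨η, by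
        rw [show (⟨1, one_mem _⟩ : Weyl b) = 1 from rfl, mul_one]
        exact Relation.ReflTransGen.refl⟩
    | mul g₁ g₂ h₁ h₂ ih₁ ih₂ =>
      intro w η
      obtain ⟨ε, h⟩ := ih₁ w η
      obtain ⟨ε', h'⟩ := ih₂ (w * ⟨g₁, h₁⟩) ε
      refine ⟨ε', ?_⟩
      rw [show (⟨g₁ * g₂, mul_mem h₁ h₂⟩ : Weyl b) = ⟨g₁, h₁⟩ * ⟨g₂, h₂⟩ from rfl, ← mul_assoc]
      exact h.trans h'
  obtain ⟨ε, h⟩ := key _ (w⁻¹ * u).2 w η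
  rw [Subtype.coe_eta, mul_inv_cancel_left] at h
  exact ⟨ε, h⟩

/-- The sign vector `η` describes the signs of the coordinates of `y`. -/
def HasSigns (η : Signs b) (y : b.support → ℝ) : Prop :=
  ∀ i, y i = ((η i : ℤ) : ℝ) * |y i|

omit [P.IsCrystallographic] in
lemma exists_hasSigns (y : b.support → ℝ) : ∃ η : Signs b, HasSigns η y := by
  refine ⟨fun i => if 0 ≤ y i then 1 else -1, fun i => ?_⟩
  by_cases h : 0 ≤ y i
  · simp [h, abs_of_nonneg h]
  · simp [h, abs_of_neg (not_le.1 h)]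

omit [P.IsCrystallographic] in
lemma HasSigns.eq_of_ne_zero {η η' : Signs b} {y : b.support → ℝ} (h : HasSigns η y)
    (h' : HasSigns η' y) {i : b.support} (hi : y i ≠ 0) : η i = η' i := by
  have := (h i).symm.trans (h' i)
  have := mul_right_cancel₀ (abs_ne_zero.2 hi) this
  exact Units.ext (by exact_mod_cast this)

/-- Supplies values away from the edge, where neither uniqueness nor continuity will matter. -/
lemma exists_boxParametrization_value [Finite ι] [P.IsRootSystem] (δ : MarkedDynkinDiagram b)
    (x₀ : N) (w : Weyl b) {y : b.support → ℝ} (hy : y ∈ boxDomain b x₀ w) :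
    ∃ (p : Space δ x₀) (η ε : Signs b) (u : Weyl b) (hx : boxPoint b x₀ w y ∈ chamber b x₀ u),
      HasSigns η y ∧ SameSheet δ (η, w) (ε, u) ∧
        p = proj δ x₀ ⟨(ε, u), boxPoint b x₀ w y, hx⟩ := by
  obtain ⟨η, hη⟩ := exists_hasSigns y
  obtain ⟨u, hu⟩ := exists_forall_root'_nonneg b (boxPoint b x₀ w y)
  obtain ⟨ε, hε⟩ := exists_sameSheet δ η w u
  have hmem := interior_subset (s := {y | boxPoint b x₀ w y ∈ polytope b x₀}) hy
  exact ⟨_, η, ε, u, ⟨hmem, hu⟩, hη, hε, rfl⟩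

end WeylGroup

section EdgeNeighbourhood

variable {ι M N : Type*} [AddCommGroup M] [Module ℝ M] [NormedAddCommGroup N] [NormedSpace ℝ N]
  {P : RootPairing ι ℝ M N}

/-! ### The neighbourhood of an edge of the polytope -/

/-- The point with box coordinates `y` at the identity. -/
def boxVec (b : P.Base) (x₀ : N) (y : b.support → ℝ) : N :=
  x₀ - ∑ i : b.support, y i ^ 2 • P.coroot i

variable {b : P.Base} {x₀ : N}

lemma boxPoint_eq (w : Weyl b) (y : b.support → ℝ) :
    boxPoint b x₀ w y = (w : N ≃ₗ[ℝ] N) (boxVec b x₀ y) := rfl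

lemma symm_boxPoint (w : Weyl b) (y : b.support → ℝ) :
    (w : N ≃ₗ[ℝ] N).symm (boxPoint b x₀ w y) = boxVec b x₀ y :=
  LinearEquiv.symm_apply_apply _ _

lemma root'_boxVec (k : b.support) (y : b.support → ℝ) :
    P.root' k (boxVec b x₀ y) = P.root' k x₀ - ∑ j : b.support, y j ^ 2 * P.pairing k j := by
  simp [boxVec]

lemma continuous_root'_boxVec (k : b.support) :
    Continuous fun y => P.root' k (boxVec b x₀ y) := by
  simp only [root'_boxVec]
  fun_prop

lemma continuous_boxPoint (w : Weyl b) : Continuous (boxPoint b x₀ w) := by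
  have : boxPoint b x₀ w = fun y => (w : N ≃ₗ[ℝ] N) x₀ -
      ∑ i : b.support, y i ^ 2 • (w : N ≃ₗ[ℝ] N) (P.coroot i) := by
    funext y
    simp [boxPoint]
  rw [this]
  fun_prop

lemma facetCoord_boxPoint [P.IsRootSystem] (w : Weyl b) (k : b.support) (y : b.support → ℝ) :
    facetCoord b x₀ w k (boxPoint b x₀ w y) = y k ^ 2 := by
  rw [facetCoord, symm_boxPoint, boxVec, sub_sub_cancel]
  simp only [← b.toCoweightBasis_apply]
  exact congrFun (b.toCoweightBasis.repr_sum_self fun k => y k ^ 2) k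

/-- The reflection subtracts a multiple of `α_i^∨`, so it alters only the `i`-th squared coordinate.
-/
lemma coreflection_boxVec {i : b.support} {y y' : b.support → ℝ}
    (hne : ∀ k, k ≠ i → y' k ^ 2 = y k ^ 2)
    (hi : y' i ^ 2 = y i ^ 2 + P.root' i (boxVec b x₀ y)) :
    boxVec b x₀ y' = P.coreflection i (boxVec b x₀ y) := by
  classical
  rw [P.coreflection_apply]
  conv_rhs => enter [1]; rw [boxVec]
  rw [boxVec, sub_sub]
  congr 1
  rw [← Finset.add_sum_erase _ _ (Finset.mem_univ i),
    ← Finset.add_sum_erase (a := i) _ (fun k : b.support => y k ^ 2 • P.coroot k)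
      (Finset.mem_univ i), hi, add_smul,
    Finset.sum_congr rfl fun k hk => by rw [hne k (Finset.ne_of_mem_erase hk)]]
  abel

/-- The point is a convex combination of the vertex `w x₀` and its neighbours `w s_k x₀ = w (x₀ -
α_k(x₀) α_k^∨)`, the latter with weights `y k ^ 2 / α_k(x₀)`. -/
lemma boxVec_mem_polytope (w : Weyl b) (hx₀ : ∀ i : b.support, 0 < P.root' i x₀)
    {y : b.support → ℝ} (hy : ∑ k : b.support, y k ^ 2 / P.root' k x₀ ≤ 1) :
    boxPoint b x₀ w y ∈ polytope b x₀ := by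
  have hmem : ∀ u : Weyl b, (u : N ≃ₗ[ℝ] N) x₀ ∈ polytope b x₀ := fun u =>
    subset_convexHull ℝ _ ⟨u, rfl⟩
  have hsum := (convex_convexHull ℝ (Set.range fun w : Weyl b => (w : N ≃ₗ[ℝ] N) x₀)).sum_mem
    (t := Finset.univ) (w := fun o : Option b.support =>
      o.elim (1 - ∑ k : b.support, y k ^ 2 / P.root' k x₀) fun k => y k ^ 2 / P.root' k x₀)
    (z := fun o : Option b.support =>
      o.elim ((w : N ≃ₗ[ℝ] N) x₀) fun k => ((w * simpleReflection b k : Weyl b) : N ≃ₗ[ℝ] N) x₀)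
    (by
      rintro (_ | k) -
      · simpa using hy
      · exact div_nonneg (sq_nonneg _) (hx₀ k).le)
    (by simp [Fintype.sum_option])
    (by
      rintro (_ | k) -
      · exact hmem w
      · exact hmem _)
  refine (congrArg (· ∈ polytope b x₀) ?_).mp hsum
  rw [Fintype.sum_option]
  simp only [Option.elim, mul_simpleReflection_apply, P.coreflection_apply, map_sub, map_smul,
    smul_sub, smul_smul, Finset.sum_sub_distrib, boxPoint, map_sum, ← Finset.sum_smul, sub_smul,
    one_smul]
  rw [sub_add_sub_cancel]
  congr 1
  exact Finset.sum_congr rfl fun k _ => by rw [div_mul_cancel₀ _ (hx₀ k).ne']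

/-- An open neighbourhood, in box coordinates, of the edge of the polytope in direction `i`. On it
only the internal `i`-wall is crossed. -/
def edgeNhd (b : P.Base) (x₀ : N) (i : b.support) : Set (b.support → ℝ) :=
  {y | ∑ k : b.support, y k ^ 2 / P.root' k x₀ < 1 ∧ ∀ k, k ≠ i →
    0 < P.root' k (boxVec b x₀ y) ∧ 0 < P.root' k (P.coreflection i (boxVec b x₀ y))}

lemma isOpen_edgeNhd (i : b.support) : IsOpen (edgeNhd b x₀ i) := by
  have h : edgeNhd b x₀ i = {y | ∑ k : b.support, y k ^ 2 / P.root' k x₀ < 1} ∩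
      ⋂ k : b.support, {y | k ≠ i → 0 < P.root' k (boxVec b x₀ y) ∧
        0 < P.root' k (P.coreflection i (boxVec b x₀ y))} := by
    ext y
    simp [edgeNhd]
  rw [h]
  refine (isOpen_lt (by fun_prop) continuous_const).inter (isOpen_iInter_of_finite fun k => ?_)
  by_cases hk : k = i
  · simp [hk]
  · simp only [ne_eq, hk, not_false_eq_true, forall_const, Set.ofPred_and]
    refine (isOpen_lt continuous_const (continuous_root'_boxVec k)).inter
      (isOpen_lt continuous_const ?_)
    simp only [P.coreflection_apply, map_sub, map_smul]
    exact (continuous_root'_boxVec k).sub ((continuous_root'_boxVec i).smul continuous_const)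

lemma edgeNhd_subset_boxDomain (hx₀ : ∀ i : b.support, 0 < P.root' i x₀) (w : Weyl b)
    (i : b.support) : edgeNhd b x₀ i ⊆ boxDomain b x₀ w :=
  interior_maximal (fun _ hy => boxVec_mem_polytope w hx₀ hy.1.le) (isOpen_edgeNhd i)

lemma root'_boxVec_single [DecidableEq b.support] (k i : b.support) (t : ℝ) :
    P.root' k (boxVec b x₀ (Pi.single i t)) = P.root' k x₀ - t ^ 2 * P.pairing k i := by
  rw [root'_boxVec, Finset.sum_eq_single i (fun j _ hj => by simp [hj]) (by simp)]
  simp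

lemma pairing_nonpos [Finite ι] [P.IsCrystallographic] {i k : b.support} (hk : k ≠ i) :
    P.pairing k i ≤ 0 := by
  rw [← b.algebraMap_cartanMatrixIn_apply ℤ k i]
  exact Int.cast_nonpos.2 (b.cartanMatrix_le_zero_of_ne k i hk)

/-- The bound on `t` reaches exactly to the midpoint of the edge. Up to there `α_i ≥ 0`, and since
`α_k(α_i^∨) ≤ 0`, neither moving along the edge nor reflecting decreases `α_k` below `α_k(x₀)`. -/
lemma single_mem_edgeNhd [Finite ι] [P.IsCrystallographic] [DecidableEq b.support]
    (hx₀ : ∀ i : b.support, 0 < P.root' i x₀)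
    {i : b.support} {t : ℝ} (ht : t ^ 2 ≤ P.root' i x₀ / 2) :
    Pi.single i t ∈ edgeNhd b x₀ i := by
  have hi := hx₀ i
  refine ⟨?_, fun k hk => ?_⟩
  · rw [Finset.sum_eq_single i (fun j _ hj => by simp [hj]) (by simp), Pi.single_eq_same,
      div_lt_one hi]
    linarith
  · have hp := pairing_nonpos hk
    have hk0 := hx₀ k
    rw [P.coreflection_apply, map_sub, map_smul, root'_boxVec_single, root'_boxVec_single,
      P.root'_coroot_eq_pairing, P.pairing_same, smul_eq_mul]
    constructor
    · nlinarith [sq_nonneg t]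
    · nlinarith [sq_nonneg t]

lemma boxPoint_mem_chamber (hx₀ : ∀ i : b.support, 0 < P.root' i x₀) (w : Weyl b) {i : b.support}
    {y : b.support → ℝ} (hy : y ∈ edgeNhd b x₀ i) (h : 0 ≤ P.root' i (boxVec b x₀ y)) :
    boxPoint b x₀ w y ∈ chamber b x₀ w := by
  refine ⟨boxVec_mem_polytope w hx₀ hy.1.le, fun k => ?_⟩
  rw [symm_boxPoint]
  by_cases hk : k = i
  · rwa [hk]
  · exact (hy.2 k hk).1.le

lemma boxPoint_mem_chamber_mul (hx₀ : ∀ i : b.support, 0 < P.root' i x₀) (w : Weyl b)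
    {i : b.support} {y : b.support → ℝ} (hy : y ∈ edgeNhd b x₀ i)
    (h : P.root' i (boxVec b x₀ y) ≤ 0) :
    boxPoint b x₀ w y ∈ chamber b x₀ (w * simpleReflection b i) := by
  refine ⟨boxVec_mem_polytope w hx₀ hy.1.le, fun k => ?_⟩
  rw [mul_simpleReflection_symm_apply, symm_boxPoint]
  by_cases hk : k = i
  · rw [hk, P.coreflection_apply, map_sub, map_smul, P.root'_coroot_eq_pairing, P.pairing_same,
      smul_eq_mul]
    linarith
  · exact (hy.2 k hk).2.le

lemma root'_nonneg_of_mem_chamber {w : Weyl b} {y : b.support → ℝ}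
    (h : boxPoint b x₀ w y ∈ chamber b x₀ w) (i : b.support) :
    0 ≤ P.root' i (boxVec b x₀ y) := by
  simpa only [symm_boxPoint] using h.2 i

lemma root'_nonpos_of_mem_chamber_mul {w : Weyl b} {y : b.support → ℝ} {i : b.support}
    (h : boxPoint b x₀ w y ∈ chamber b x₀ (w * simpleReflection b i)) :
    P.root' i (boxVec b x₀ y) ≤ 0 := by
  have := h.2 i
  rw [mul_simpleReflection_symm_apply, symm_boxPoint, P.coreflection_apply, map_sub, map_smul,
    P.root'_coroot_eq_pairing, P.pairing_same, smul_eq_mul] at this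
  linarith

/-- The `i`-th coordinate does not vanish beyond the internal `i`-wall. -/
lemma coord_ne_zero_of_mem_chamber_mul [Finite ι] [P.IsCrystallographic]
    (hx₀ : ∀ i : b.support, 0 < P.root' i x₀) {w : Weyl b}
    {y : b.support → ℝ} {i : b.support}
    (h : boxPoint b x₀ w y ∈ chamber b x₀ (w * simpleReflection b i)) : y i ≠ 0 := by
  intro h0
  have h1 := root'_nonpos_of_mem_chamber_mul h
  rw [root'_boxVec] at h1
  have h2 : ∑ j : b.support, y j ^ 2 * P.pairing i j ≤ 0 := by
    refine Finset.sum_nonpos fun j _ => ?_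
    by_cases hj : j = i
    · simp [hj, h0]
    · exact mul_nonpos_of_nonneg_of_nonpos (sq_nonneg _) (pairing_nonpos (Ne.symm hj))
  linarith [hx₀ i]

lemma facetCoord_mul_boxPoint [P.IsRootSystem] (w : Weyl b) {i k : b.support} (hk : k ≠ i)
    (y : b.support → ℝ) :
    facetCoord b x₀ (w * simpleReflection b i) k (boxPoint b x₀ w y) = y k ^ 2 := by
  have h := facetCoord_boxPoint (x₀ := x₀) w k y
  rw [facetCoord, symm_boxPoint] at h
  rw [facetCoord, mul_simpleReflection_symm_apply, symm_boxPoint, P.coreflection_apply,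
    sub_sub_eq_add_sub, add_comm, add_sub_assoc, map_add, Finsupp.add_apply, h, map_smul,
    b.toCoweightBasis_repr_coroot]
  simp [hk]

end EdgeNeighbourhood

section EdgeParametrization

variable {ι M N : Type*} [AddCommGroup M] [Module ℝ M] [NormedAddCommGroup N] [NormedSpace ℝ N]
  {P : RootPairing ι ℝ M N}

/-! ### Box parametrizations near an edge -/

variable {b : P.Base} {x₀ : N} [P.IsRootSystem] [P.IsCrystallographic]

lemma continuous_proj (δ : MarkedDynkinDiagram b) (x₀ : N) : Continuous (proj δ x₀) :=
  continuous_quot_mk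

lemma continuousOn_of_eq_proj {X : Type*} [TopologicalSpace X] {δ : MarkedDynkinDiagram b}
    {K : Set X} {g : X → Space δ x₀} {f : X → N} {q : Signs b × Weyl b} (hf : Continuous f)
    (h : ∀ y ∈ K, ∃ hx : f y ∈ chamber b x₀ q.2, g y = proj δ x₀ ⟨q, f y, hx⟩) :
    ContinuousOn g K := by
  rw [continuousOn_iff_continuous_domRestrict]
  choose hx hg using h
  exact ((continuous_proj δ x₀).comp (continuous_sigmaMk.comp
    ((hf.comp continuous_subtype_val).subtype_mk fun y : K => hx y y.2))).congr
      fun y => (hg y y.2).symm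

lemma proj_congr (δ : MarkedDynkinDiagram b) {ε ε' : Signs b} {w w' : Weyl b} {x x' : N}
    (hε : ε = ε') (hw : w = w') (hx : x = x') (h : x ∈ chamber b x₀ w)
    (h' : x' ∈ chamber b x₀ w') :
    proj δ x₀ ⟨(ε, w), x, h⟩ = proj δ x₀ ⟨(ε', w'), x', h'⟩ := by
  subst hε hw hx
  rfl

/-- Signs may be changed freely in the directions of the external walls containing the point. -/
lemma proj_eq_of_facetCoord_eq_zero (δ : MarkedDynkinDiagram b) {ε ε' : Signs b} {w : Weyl b}
    {x : N} (hx : x ∈ chamber b x₀ w) (h : ∀ k, ε k ≠ ε' k → facetCoord b x₀ w k x = 0) :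
    proj δ x₀ ⟨(ε, w), x, hx⟩ = proj δ x₀ ⟨(ε', w), x, hx⟩ := by
  classical
  -- The signs are changed one coordinate at a time, each change crossing a single external wall.
  suffices H : ∀ T : Finset b.support, proj δ x₀ ⟨(ε, w), x, hx⟩ =
      proj δ x₀ ⟨(fun k => if k ∈ T then ε' k else ε k, w), x, hx⟩ by
    rw [H Finset.univ]
    exact proj_congr δ (by simp) rfl rfl _ _
  intro T
  induction T using Finset.induction_on with
  | empty => exact proj_congr δ (by simp) rfl rfl _ _
  | insert a T ha ih =>
    rw [ih]
    by_cases hk : ε a = ε' a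
    · refine proj_congr δ (funext fun k => ?_) rfl rfl _ _
      by_cases hka : k = a
      · simp [hka, ha, hk]
      · simp [hka]
    · refine (Quot.sound (Glue.outer _ w a x hx ⟨hx, h a hk⟩)).trans
        (proj_congr δ (funext fun k => ?_) rfl rfl _ _)
      by_cases hka : k = a
      · subst hka
        simpa [flipSign, ha] using (Int.units_ne_iff_eq_neg.1 (Ne.symm hk)).symm
      · simp [flipSign, hka]

omit [P.IsRootSystem] in
lemma MarkedDynkinDiagram.act_self (δ : MarkedDynkinDiagram b) (i : b.support) (η : Signs b) :
    δ.act i η i = η i := by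
  simp [MarkedDynkinDiagram.act, δ.sign_self]

omit [P.IsRootSystem] in
lemma MarkedDynkinDiagram.act_act (δ : MarkedDynkinDiagram b) (i : b.support) (η : Signs b) :
    δ.act i (δ.act i η) = η := by
  funext j
  rw [MarkedDynkinDiagram.act, δ.act_self]
  by_cases h : η i = -1
  · simp [MarkedDynkinDiagram.act, h, mul_assoc]
  · simp [MarkedDynkinDiagram.act, h]

/-- The point `p` of `M(δ)` lies over the point with box coordinates `y` at `w`, in the sheet given
by the signs of `y`; only the two chambers along the edge in direction `i` are considered. -/
def IsEdgeValue (δ : MarkedDynkinDiagram b) (x₀ : N) (w : Weyl b) (i : b.support)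
    (y : b.support → ℝ) (p : Space δ x₀) : Prop :=
  ∀ η : Signs b, HasSigns η y →
    (∀ hx : boxPoint b x₀ w y ∈ chamber b x₀ w,
      p = proj δ x₀ ⟨(η, w), boxPoint b x₀ w y, hx⟩) ∧
    ∀ hx : boxPoint b x₀ w y ∈ chamber b x₀ (w * simpleReflection b i),
      p = proj δ x₀ ⟨(δ.act i η, w * simpleReflection b i), boxPoint b x₀ w y, hx⟩

variable [Finite ι]

/-- Two ambiguities have to agree in the quotient: signs at vanishing coordinates are identified by
the external gluings, and the two chambers at the internal wall by the internal gluing. -/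
lemma exists_isEdgeValue (δ : MarkedDynkinDiagram b) (hx₀ : ∀ i : b.support, 0 < P.root' i x₀)
    (w : Weyl b) {i : b.support} {y : b.support → ℝ} (hy : y ∈ edgeNhd b x₀ i) :
    ∃ p, IsEdgeValue δ x₀ w i y p := by
  obtain ⟨η, hη⟩ := exists_hasSigns y
  have hsame : ∀ η', HasSigns η' y → ∀ hx : boxPoint b x₀ w y ∈ chamber b x₀ w,
      proj δ x₀ ⟨(η, w), boxPoint b x₀ w y, hx⟩ = proj δ x₀ ⟨(η', w), boxPoint b x₀ w y, hx⟩ := by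
    intro η' hη' hx
    refine proj_eq_of_facetCoord_eq_zero δ hx fun k hk => ?_
    rw [facetCoord_boxPoint, sq_eq_zero_iff]
    by_contra h
    exact hk (hη.eq_of_ne_zero hη' h)
  have hsame' : ∀ η', HasSigns η' y →
      ∀ hx : boxPoint b x₀ w y ∈ chamber b x₀ (w * simpleReflection b i),
      proj δ x₀ ⟨(δ.act i η, w * simpleReflection b i), boxPoint b x₀ w y, hx⟩ =
        proj δ x₀ ⟨(δ.act i η', w * simpleReflection b i), boxPoint b x₀ w y, hx⟩ := by
    intro η' hη' hx
    -- Beyond the wall `y i ≠ 0`, so both sign vectors undergo the same twist.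
    have hi := hη.eq_of_ne_zero hη' (coord_ne_zero_of_mem_chamber_mul hx₀ hx)
    refine proj_eq_of_facetCoord_eq_zero δ hx fun k hk => ?_
    have hki : k ≠ i := by
      rintro rfl
      rw [δ.act_self, δ.act_self] at hk
      exact hk hi
    rw [facetCoord_mul_boxPoint w hki, sq_eq_zero_iff]
    by_contra h
    exact hk (by simp only [MarkedDynkinDiagram.act, hi, hη.eq_of_ne_zero hη' h])
  have hcross : ∀ (hx : boxPoint b x₀ w y ∈ chamber b x₀ w)
      (hx' : boxPoint b x₀ w y ∈ chamber b x₀ (w * simpleReflection b i)),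
      proj δ x₀ ⟨(η, w), boxPoint b x₀ w y, hx⟩ =
        proj δ x₀ ⟨(δ.act i η, w * simpleReflection b i), boxPoint b x₀ w y, hx'⟩ := by
    intro hx hx'
    refine Quot.sound (Glue.inner η w i _ hx hx' ⟨hx, ?_⟩)
    rw [symm_boxPoint]
    exact le_antisymm (root'_nonpos_of_mem_chamber_mul hx') (root'_nonneg_of_mem_chamber hx i)
  rcases le_total 0 (P.root' i (boxVec b x₀ y)) with h | h
  · have hx := boxPoint_mem_chamber hx₀ w hy h
    exact ⟨_, fun η' hη' => ⟨fun _ => hsame η' hη' hx,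
      fun hx' => (hcross hx hx').trans (hsame' η' hη' hx')⟩⟩
  · have hx' := boxPoint_mem_chamber_mul hx₀ w hy h
    exact ⟨_, fun η' hη' => ⟨fun hx => (hcross hx hx').symm.trans (hsame η' hη' hx),
      fun _ => hsame' η' hη' hx'⟩⟩

/-- Values outside the edge neighbourhood may be chosen arbitrarily among the admissible ones, since
smooth charts are tested against every box parametrization. -/
lemma exists_edgeParametrization (δ : MarkedDynkinDiagram b)
    (hx₀ : ∀ i : b.support, 0 < P.root' i x₀) (w : Weyl b) (i : b.support) :
    ∃ φ, IsBoxParametrization δ x₀ w φ ∧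
      ∀ y ∈ edgeNhd b x₀ i, IsEdgeValue δ x₀ w i y (φ y) := by
  classical
  have _n : Nonempty (Space δ x₀) := by
    obtain ⟨p, -⟩ := exists_isEdgeValue δ hx₀ w (single_mem_edgeNhd hx₀ (i := i) (t := 0)
      (by simpa using (half_pos (hx₀ i)).le))
    exact ⟨p⟩
  choose! f hf using fun y (hy : y ∈ edgeNhd b x₀ i) => exists_isEdgeValue δ hx₀ w hy
  choose! g hg using fun y (hy : y ∈ boxDomain b x₀ w) => exists_boxParametrization_value δ x₀ w hy
  refine ⟨fun y => if y ∈ edgeNhd b x₀ i then f y else g y, fun y hy => ?_, fun y hy => ?_⟩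
  · by_cases hy' : y ∈ edgeNhd b x₀ i
    · simp only [hy', if_true]
      obtain ⟨η, hη⟩ := exists_hasSigns y
      rcases le_total 0 (P.root' i (boxVec b x₀ y)) with h | h
      · have hx := boxPoint_mem_chamber hx₀ w hy' h
        exact ⟨η, η, w, hx, hη, Relation.ReflTransGen.refl, (hf y hy' η hη).1 hx⟩
      · have hx := boxPoint_mem_chamber_mul hx₀ w hy' h
        exact ⟨η, _, _, hx, hη, Relation.ReflTransGen.single ⟨i, rfl⟩, (hf y hy' η hη).2 hx⟩
    · simp only [hy', if_false]
      exact hg y hy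
  · simp only [hy, if_true]
    exact hf y hy

omit [Finite ι] in
-- Sign vectors and the two sides of the wall cut the neighbourhood into finitely many closed
-- pieces. On each, `φ` is a continuous map into one chamber followed by the projection.
lemma continuousOn_edgeParametrization (δ : MarkedDynkinDiagram b)
    (hx₀ : ∀ i : b.support, 0 < P.root' i x₀) (w : Weyl b) (i : b.support)
    {φ : (b.support → ℝ) → Space δ x₀}
    (hφ : ∀ y ∈ edgeNhd b x₀ i, IsEdgeValue δ x₀ w i y (φ y)) :
    ContinuousOn φ (edgeNhd b x₀ i) := by
  rw [continuousOn_iff_continuous_domRestrict]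
  have hcoord : ∀ k, Continuous fun y : edgeNhd b x₀ i => (y : b.support → ℝ) k := fun k =>
    (continuous_apply k).comp continuous_subtype_val
  have hsigns : ∀ η : Signs b, IsClosed {y : edgeNhd b x₀ i | HasSigns η (y : b.support → ℝ)} := by
    intro η
    simp only [HasSigns, Set.ofPred_forall]
    exact isClosed_iInter fun k => isClosed_eq (hcoord k) (continuous_const.mul (hcoord k).abs)
  have hroot : Continuous fun y : edgeNhd b x₀ i => P.root' i (boxVec b x₀ y) :=
    (continuous_root'_boxVec i).comp continuous_subtype_val
  refine LocallyFinite.continuous (ι := Signs b × Bool) (f := fun q =>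
    {y : edgeNhd b x₀ i | HasSigns q.1 (y : b.support → ℝ)} ∩
      bif q.2 then {y | 0 ≤ P.root' i (boxVec b x₀ y)} else {y | P.root' i (boxVec b x₀ y) ≤ 0})
    (locallyFinite_of_finite _) ?_ ?_ ?_
  · refine Set.eq_univ_of_forall fun y => Set.mem_iUnion.2 ?_
    obtain ⟨η, hη⟩ := exists_hasSigns (y : b.support → ℝ)
    rcases le_total 0 (P.root' i (boxVec b x₀ y)) with h | h
    · exact ⟨(η, true), hη, h⟩
    · exact ⟨(η, false), hη, h⟩
  · rintro ⟨η, _ | _⟩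
    · exact (hsigns η).inter (isClosed_le hroot continuous_const)
    · exact (hsigns η).inter (isClosed_le continuous_const hroot)
  · have hpt : Continuous fun y : edgeNhd b x₀ i => boxPoint b x₀ w y :=
      (continuous_boxPoint w).comp continuous_subtype_val
    rintro ⟨η, _ | _⟩
    · refine continuousOn_of_eq_proj (q := (δ.act i η, w * simpleReflection b i)) hpt fun y hy => ?_
      exact ⟨boxPoint_mem_chamber_mul hx₀ w y.2 hy.2, (hφ _ y.2 η hy.1).2 _⟩
    · refine continuousOn_of_eq_proj (q := (η, w)) hpt fun y hy => ?_
      exact ⟨boxPoint_mem_chamber hx₀ w y.2 hy.2, (hφ _ y.2 η hy.1).1 _⟩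

end EdgeParametrization

/-! ### Orientations along connected sets -/

section Orientation

open Topology Filter

variable {X E : Type*} [TopologicalSpace X] [NormedAddCommGroup E] [NormedSpace ℝ E]
  [FiniteDimensional ℝ E] [Nontrivial E] {A : Set (OpenPartialHomeomorph X E)}
  {φ : E → X} {U : Set E}

/-- Two positively related charts induce the same orientation through a parametrization. -/
lemma det_fderiv_mul_pos_of_mem_source (hU : IsOpen U) (hφ : ContinuousOn φ U)
    {e e' : OpenPartialHomeomorph X E}
    (hpos : ∀ y ∈ (e.symm.trans e').source, 0 < (fderiv ℝ (e.symm.trans e') y).det)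
    (hsmooth : ContDiffOn ℝ ∞ (e ∘ φ) (U ∩ φ ⁻¹' e.source))
    (hdet : ∀ y ∈ U ∩ φ ⁻¹' e.source, (fderiv ℝ (e ∘ φ) y).det ≠ 0)
    {y : E} (hy : y ∈ U) (he : φ y ∈ e.source) (he' : φ y ∈ e'.source) :
    0 < (fderiv ℝ (e ∘ φ) y).det * (fderiv ℝ (e' ∘ φ) y).det := by
  have hopen := hφ.isOpen_inter_preimage hU e.open_source
  have hd : DifferentiableAt ℝ (e ∘ φ) y :=
    (hsmooth.contDiffAt (hopen.mem_nhds ⟨hy, he⟩)).differentiableAt (by simp)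
  have hp := hpos (e (φ y)) (by simp [he, he'])
  -- Differentiability of the coordinate change follows from positivity: otherwise `fderiv` is `0`,
  -- with determinant `0` in positive dimension.
  have hd' : DifferentiableAt ℝ (e.symm.trans e') ((e ∘ φ) y) := by
    by_contra h
    rw [Function.comp_apply] at h
    rw [fderiv_zero_of_not_differentiableAt h, ContinuousLinearMap.det,
      ContinuousLinearMap.toLinearMap_zero, LinearMap.det_zero,
      zero_pow (Module.finrank_pos (R := ℝ) (M := E)).ne'] at hp
    exact lt_irrefl _ hp
  have heq : e' ∘ φ =ᶠ[𝓝 y] (e.symm.trans e') ∘ (e ∘ φ) := by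
    filter_upwards [hopen.mem_nhds ⟨hy, he⟩] with z hz
    simp [e.left_inv hz.2]
  rw [heq.fderiv_eq, fderiv_comp y hd' hd, ContinuousLinearMap.det,
    ContinuousLinearMap.det, ContinuousLinearMap.toLinearMap_comp, LinearMap.det_comp]
  have hne : LinearMap.det (fderiv ℝ (e ∘ φ) y : E →ₗ[ℝ] E) ≠ 0 := hdet y ⟨hy, he⟩
  have hp' : 0 < LinearMap.det (fderiv ℝ (e.symm.trans e') ((e ∘ φ) y) : E →ₗ[ℝ] E) := hp
  have := mul_pos hp' (mul_self_pos.2 hne)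
  nlinarith

/-- Along a connected set, an oriented family of charts induces a constant orientation through a
parametrization. -/
lemma det_fderiv_mul_pos_of_isPreconnected (hcov : ∀ p : X, ∃ e ∈ A, p ∈ e.source)
    (hpos : ∀ e ∈ A, ∀ e' ∈ A, ∀ y ∈ (e.symm.trans e').source,
      0 < (fderiv ℝ (e.symm.trans e') y).det)
    (hU : IsOpen U) (hφ : ContinuousOn φ U)
    (hsmooth : ∀ e ∈ A, ContDiffOn ℝ ∞ (e ∘ φ) (U ∩ φ ⁻¹' e.source))
    (hdet : ∀ e ∈ A, ∀ y ∈ U ∩ φ ⁻¹' e.source, (fderiv ℝ (e ∘ φ) y).det ≠ 0)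
    {S : Set E} (hS : IsPreconnected S) (hSU : S ⊆ U) {y y' : E} (hy : y ∈ S) (hy' : y' ∈ S)
    {e e' : OpenPartialHomeomorph X E} (he : e ∈ A) (he' : e' ∈ A) (hye : φ y ∈ e.source)
    (hye' : φ y' ∈ e'.source) :
    0 < (fderiv ℝ (e ∘ φ) y).det * (fderiv ℝ (e' ∘ φ) y').det := by
  have htrans : ∀ {a c d : ℝ}, 0 < a * c → 0 < c * d → 0 < a * d := by
    intro a c d h h'
    by_contra! hcon
    nlinarith [mul_pos h h', sq_nonneg c]
  -- Inducing the same orientation is a symmetric and transitive relation, so it suffices to check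
  -- it locally. There a single chart `e₀` serves as reference, its Jacobian determinant being
  -- continuous and nonzero.
  refine hS.induction₂ (fun y y' => ∀ e ∈ A, ∀ e' ∈ A, φ y ∈ e.source → φ y' ∈ e'.source →
    0 < (fderiv ℝ (e ∘ φ) y).det * (fderiv ℝ (e' ∘ φ) y').det) ?_ ?_ ?_ hy hy' e he e' he' hye hye'
  · intro x hx
    obtain ⟨e₀, he₀, hx₀⟩ := hcov (φ x)
    have hopen := hφ.isOpen_inter_preimage hU e₀.open_source
    have hmem := hopen.mem_nhds ⟨hSU hx, hx₀⟩
    have hcont : ContinuousAt (fun y => (fderiv ℝ (e₀ ∘ φ) x).det * (fderiv ℝ (e₀ ∘ φ) y).det) x :=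
      continuousAt_const.mul (ContinuousLinearMap.continuous_det.continuousAt.comp
        (((hsmooth e₀ he₀).continuousOn_fderiv_of_isOpen hopen (by simp)).continuousAt hmem))
    have hx0 : 0 < (fderiv ℝ (e₀ ∘ φ) x).det * (fderiv ℝ (e₀ ∘ φ) x).det :=
      mul_self_pos.2 (hdet e₀ he₀ x ⟨hSU hx, hx₀⟩)
    refine mem_nhdsWithin_of_mem_nhds ?_
    filter_upwards [hcont.eventually_const_lt hx0, hmem] with z hz hzU e he e' he' hxe hze'
    have h1 := det_fderiv_mul_pos_of_mem_source hU hφ (hpos e he e₀ he₀) (hsmooth e he) (hdet e he)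
      (hSU hx) hxe hx₀
    have h2 := det_fderiv_mul_pos_of_mem_source hU hφ (hpos e₀ he₀ e' he') (hsmooth e₀ he₀)
      (hdet e₀ he₀) hzU.1 hzU.2 hze'
    exact htrans h1 (htrans hz h2)
  · intro x y z _ _ _ hxy hyz e he e' he' hxe hze'
    obtain ⟨e₀, he₀, hy₀⟩ := hcov (φ y)
    exact htrans (hxy e he e₀ he₀ hxe hy₀) (hyz e₀ he₀ e' he' hy₀ hze')
  · intro x y _ _ hxy e he e' he' hye hxe'
    rw [mul_comm]
    exact hxy e' he' e he hxe' hye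

end Orientation

section EdgeTransition

variable {ι M N : Type*} [AddCommGroup M] [Module ℝ M] [NormedAddCommGroup N] [NormedSpace ℝ N]
  {P : RootPairing ι ℝ M N} {b : P.Base} {x₀ : N} [P.IsRootSystem] [P.IsCrystallographic]

/-! ### The coordinate change between adjacent boxes -/

/-- The factor by which crossing the internal `i`-wall at sign `ε` multiplies the `k`-th sign. -/
def wallSign (δ : MarkedDynkinDiagram b) (i : b.support) (ε : ℤˣ) (k : b.support) : ℤˣ :=
  if ε = -1 then δ.sign i k else 1

omit [P.IsRootSystem] in
lemma act_eq_mul_wallSign (δ : MarkedDynkinDiagram b) (i : b.support) (η : Signs b)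
    (k : b.support) : δ.act i η k = η k * wallSign δ i (η i) k := by
  by_cases h : η i = -1 <;> simp [MarkedDynkinDiagram.act, wallSign, h]

open Classical in
/-- The change from the box coordinates at `w` to those at `w s_i`, where the `i`-th coordinate has
the sign `ε`. -/
def edgeTransition (δ : MarkedDynkinDiagram b) (x₀ : N) (i : b.support) (ε : ℤˣ)
    (y : b.support → ℝ) : b.support → ℝ :=
  fun k => if k = i then ((ε : ℤ) : ℝ) * √(y i ^ 2 + P.root' i (boxVec b x₀ y))
    else ((wallSign δ i ε k : ℤ) : ℝ) * y k

lemma units_cast_mul_self (u : ℤˣ) : ((u : ℤ) : ℝ) * ((u : ℤ) : ℝ) = 1 := by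
  rcases Int.units_eq_one_or u with rfl | rfl <;> simp

lemma abs_units_cast (u : ℤˣ) : |((u : ℤ) : ℝ)| = 1 := by
  rcases Int.units_eq_one_or u with rfl | rfl <;> simp

omit [P.IsRootSystem] in
lemma boxPoint_edgeTransition (δ : MarkedDynkinDiagram b) (w : Weyl b) {i : b.support} {ε : ℤˣ}
    {y : b.support → ℝ} (hy : 0 ≤ y i ^ 2 + P.root' i (boxVec b x₀ y)) :
    boxPoint b x₀ (w * simpleReflection b i) (edgeTransition δ x₀ i ε y) = boxPoint b x₀ w y := by
  have h : boxVec b x₀ (edgeTransition δ x₀ i ε y) = P.coreflection i (boxVec b x₀ y) := by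
    refine coreflection_boxVec (fun k hk => ?_) ?_
    · simp only [edgeTransition, hk, if_false]
      rw [mul_pow, sq ((wallSign δ i ε k : ℤ) : ℝ), units_cast_mul_self, one_mul]
    · simp only [edgeTransition, if_true]
      rw [mul_pow, sq ((ε : ℤ) : ℝ), units_cast_mul_self, one_mul, Real.sq_sqrt hy]
  rw [boxPoint_eq, boxPoint_eq, mul_simpleReflection_apply, h, P.coreflection_same]

omit [P.IsRootSystem] in
lemma HasSigns.edgeTransition {δ : MarkedDynkinDiagram b} {η : Signs b} {i : b.support}
    {y : b.support → ℝ} (h : HasSigns η y) :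
    HasSigns (δ.act i η) (edgeTransition δ x₀ i (η i) y) := by
  intro k
  by_cases hk : k = i
  · subst hk
    simp only [TwistedTomei.edgeTransition, if_true, δ.act_self]
    rw [abs_mul, abs_units_cast, one_mul, abs_of_nonneg (Real.sqrt_nonneg _)]
  · simp only [TwistedTomei.edgeTransition, hk, if_false]
    rw [abs_mul, abs_units_cast, one_mul, act_eq_mul_wallSign]
    conv_lhs => rw [h k]
    push_cast
    ring

/-- The parametrizations at `w` and `w s_i` differ by the coordinate change along the edge. -/
lemma eq_comp_edgeTransition {δ : MarkedDynkinDiagram b}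
    (hx₀ : ∀ i : b.support, 0 < P.root' i x₀) {w : Weyl b} {i : b.support}
    {φ ψ : (b.support → ℝ) → Space δ x₀}
    (hφ : ∀ y ∈ edgeNhd b x₀ i, IsEdgeValue δ x₀ w i y (φ y))
    (hψ : ∀ y ∈ edgeNhd b x₀ i, IsEdgeValue δ x₀ (w * simpleReflection b i) i y (ψ y))
    {ε : ℤˣ} {y : b.support → ℝ} (hy : y ∈ edgeNhd b x₀ i)
    (hTy : edgeTransition δ x₀ i ε y ∈ edgeNhd b x₀ i) (hε : 0 < ((ε : ℤ) : ℝ) * y i)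
    (hnonneg : 0 ≤ y i ^ 2 + P.root' i (boxVec b x₀ y)) :
    φ y = ψ (edgeTransition δ x₀ i ε y) := by
  obtain ⟨η, hη⟩ := exists_hasSigns y
  have hηε : ε = η i := by
    by_contra hne
    have h1 : ((ε : ℤ) : ℝ) = -((η i : ℤ) : ℝ) := by
      rw [Int.units_ne_iff_eq_neg.1 hne]
      simp
    rw [hη i, h1, ← mul_assoc, neg_mul, units_cast_mul_self] at hε
    linarith [abs_nonneg (y i)]
  subst hηε
  have hpt := boxPoint_edgeTransition δ w (ε := η i) hnonneg
  have hη' := hη.edgeTransition (δ := δ) (x₀ := x₀) (i := i)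
  -- The chambers swap roles: the chamber `w` lies beyond the wall as seen from `w s_i`, and
  -- crossing back undoes the twist of signs.
  rcases le_total 0 (P.root' i (boxVec b x₀ y)) with h | h
  · have hx := boxPoint_mem_chamber hx₀ w hy h
    have hw : w * simpleReflection b i * simpleReflection b i = w := by
      rw [mul_assoc, simpleReflection_mul_self, mul_one]
    have hx' : boxPoint b x₀ (w * simpleReflection b i) (edgeTransition δ x₀ i (η i) y) ∈
        chamber b x₀ (w * simpleReflection b i * simpleReflection b i) := by
      rw [hpt, hw]
      exact hx
    rw [(hφ y hy η hη).1 hx, (hψ _ hTy _ hη').2 hx']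
    exact proj_congr δ (δ.act_act i η).symm hw.symm hpt.symm _ _
  · have hx := boxPoint_mem_chamber_mul hx₀ w hy h
    have hx' : boxPoint b x₀ (w * simpleReflection b i) (edgeTransition δ x₀ i (η i) y) ∈
        chamber b x₀ (w * simpleReflection b i) := by
      rw [hpt]
      exact hx
    rw [(hφ y hy η hη).2 hx, (hψ _ hTy _ hη').1 hx']
    exact proj_congr δ rfl rfl hpt.symm _ _

/-- Half the length of the edge, in box coordinates. -/
def edgeRadius (x₀ : N) (i : b.support) : ℝ := √(P.root' i x₀ / 2)

omit [P.IsRootSystem] [P.IsCrystallographic] in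
lemma edgeRadius_pos {i : b.support} (hi : 0 < P.root' i x₀) : 0 < edgeRadius x₀ i :=
  Real.sqrt_pos.2 (half_pos hi)

omit [P.IsRootSystem] [P.IsCrystallographic] in
lemma edgeRadius_sq {i : b.support} (hi : 0 < P.root' i x₀) :
    edgeRadius x₀ i ^ 2 = P.root' i x₀ / 2 :=
  Real.sq_sqrt (half_pos hi).le

open Classical in
/-- The point where the edge crosses the internal wall, with sign `ε`. -/
def edgeMidpoint (x₀ : N) (i : b.support) (ε : ℤˣ) : b.support → ℝ :=
  Pi.single i (((ε : ℤ) : ℝ) * edgeRadius x₀ i)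

omit [P.IsRootSystem] [P.IsCrystallographic] in
lemma edgeMidpoint_self (i : b.support) (ε : ℤˣ) :
    edgeMidpoint x₀ i ε i = ((ε : ℤ) : ℝ) * edgeRadius x₀ i := by
  simp [edgeMidpoint]

omit [P.IsRootSystem] [P.IsCrystallographic] in
lemma edgeMidpoint_of_ne {i k : b.support} (hk : k ≠ i) (ε : ℤˣ) : edgeMidpoint x₀ i ε k = 0 := by
  simp [edgeMidpoint, hk]

omit [P.IsRootSystem] [P.IsCrystallographic] in
lemma edgeMidpoint_self_sq {i : b.support} (hi : 0 < P.root' i x₀) (ε : ℤˣ) :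
    edgeMidpoint x₀ i ε i ^ 2 = P.root' i x₀ / 2 := by
  rw [edgeMidpoint_self, mul_pow, sq ((ε : ℤ) : ℝ), units_cast_mul_self, one_mul, edgeRadius_sq hi]

omit [P.IsRootSystem] [P.IsCrystallographic] in
lemma root'_boxVec_edgeMidpoint {i : b.support} (hi : 0 < P.root' i x₀) (ε : ℤˣ) :
    P.root' i (boxVec b x₀ (edgeMidpoint x₀ i ε)) = 0 := by
  classical
  have h := edgeMidpoint_self_sq hi ε
  rw [edgeMidpoint_self] at h
  have h' := root'_boxVec_single (x₀ := x₀) i i (((ε : ℤ) : ℝ) * edgeRadius x₀ i)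
  rw [P.pairing_same, h] at h'
  rw [edgeMidpoint]
  convert h' using 1
  ring

omit [P.IsRootSystem] in
lemma edgeTransition_edgeMidpoint (δ : MarkedDynkinDiagram b) {i : b.support}
    (hi : 0 < P.root' i x₀) (ε : ℤˣ) :
    edgeTransition δ x₀ i ε (edgeMidpoint x₀ i ε) = edgeMidpoint x₀ i ε := by
  funext k
  by_cases hk : k = i
  · subst hk
    simp only [edgeTransition, if_true]
    rw [root'_boxVec_edgeMidpoint hi, add_zero, edgeMidpoint_self_sq hi, edgeMidpoint_self]
    rfl
  · simp [edgeTransition, hk, edgeMidpoint_of_ne hk]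

omit [P.IsRootSystem] in
open Classical in
-- The radicand `y_i ^ 2 + α_i` has derivative `2 y_i - 4 y_i = -2 y_i` in direction `i`, because
-- `α_i(α_i^∨) = 2`; the other partial derivatives vanish with the other coordinates. Its square
-- root at the midpoint is `|y_i|`, which gives the entry `-1`.
lemma hasFDerivAt_edgeTransition (δ : MarkedDynkinDiagram b) {i : b.support}
    (hi : 0 < P.root' i x₀) (ε : ℤˣ) :
    HasFDerivAt (edgeTransition δ x₀ i ε)
      (ContinuousLinearMap.pi fun k => (if k = i then -1 else ((wallSign δ i ε k : ℤ) : ℝ)) •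
        ContinuousLinearMap.proj (R := ℝ) (φ := fun _ : b.support => ℝ) k)
      (edgeMidpoint x₀ i ε) := by
  rw [hasFDerivAt_pi]
  intro k
  by_cases hk : k = i
  · subst hk
    simp only [edgeTransition, if_true]
    have hr := edgeRadius_pos hi
    have hcoord : ∀ j : b.support, HasFDerivAt (fun y : b.support → ℝ => y j ^ 2)
        ((2 * edgeMidpoint x₀ k ε j) •
          ContinuousLinearMap.proj (R := ℝ) (φ := fun _ : b.support => ℝ) j)
        (edgeMidpoint x₀ k ε) := fun j => by
      simpa using (hasFDerivAt_apply (𝕜 := ℝ) j (edgeMidpoint x₀ k ε)).pow 2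
    have hg : HasFDerivAt (fun y : b.support → ℝ => y k ^ 2 + P.root' k (boxVec b x₀ y))
        ((-2 * edgeMidpoint x₀ k ε k) •
          ContinuousLinearMap.proj (R := ℝ) (φ := fun _ : b.support => ℝ) k)
        (edgeMidpoint x₀ k ε) := by
      simp only [root'_boxVec]
      refine ((hcoord k).add ((hasFDerivAt_const (P.root' k x₀) _).sub (HasFDerivAt.fun_sum
        fun j _ => (hcoord j).mul_const (P.pairing k j)))).congr_fderiv ?_
      rw [Finset.sum_eq_single k (fun j _ hj => by simp [edgeMidpoint_of_ne hj]) (by simp),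
        P.pairing_same]
      ext y
      simp
      ring
    have hval : edgeMidpoint x₀ k ε k ^ 2 + P.root' k (boxVec b x₀ (edgeMidpoint x₀ k ε)) =
        edgeRadius x₀ k ^ 2 := by
      rw [root'_boxVec_edgeMidpoint hi, add_zero, edgeMidpoint_self_sq hi, edgeRadius_sq hi]
    refine ((hg.sqrt (by rw [hval]; positivity)).const_mul ((ε : ℤ) : ℝ)).congr_fderiv ?_
    rw [hval, Real.sqrt_sq hr.le, edgeMidpoint_self]
    ext y
    simp only [smul_apply, ContinuousLinearMap.proj_apply, smul_eq_mul]
    field_simp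
    linear_combination (-y k) * units_cast_mul_self ε
  · simp only [edgeTransition, hk, if_false]
    exact (hasFDerivAt_apply (𝕜 := ℝ) k _).const_mul _

open Classical in
lemma det_pi_smul_proj {I : Type*} [Fintype I] (d : I → ℝ) :
    (ContinuousLinearMap.pi fun k => d k •
      ContinuousLinearMap.proj (R := ℝ) (φ := fun _ : I => ℝ) k).det = ∏ k, d k := by
  rw [← Matrix.det_diagonal, ← LinearMap.det_toLin', ContinuousLinearMap.det]
  congr 1
  ext y k
  simp [Matrix.mulVec_diagonal]

omit [P.IsRootSystem] in
-- The product of the wall signs is `ε`: it is empty of twists for `ε = 1` and equals the row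
-- product `-1` for `ε = -1`. Direction `i` adds a factor `-1`.
lemma det_fderiv_edgeTransition {δ : MarkedDynkinDiagram b} {i : b.support}
    (hi : 0 < P.root' i x₀) (hprod : ∏ k, δ.sign i k = -1) (ε : ℤˣ) :
    (fderiv ℝ (edgeTransition δ x₀ i ε) (edgeMidpoint x₀ i ε)).det = -((ε : ℤ) : ℝ) := by
  classical
  rw [(hasFDerivAt_edgeTransition δ hi ε).fderiv, det_pi_smul_proj]
  have h : ∀ k, (if k = i then -1 else ((wallSign δ i ε k : ℤ) : ℝ)) =
      (if k = i then -1 else 1) * ((wallSign δ i ε k : ℤ) : ℝ) := fun k => by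
    by_cases hk : k = i
    · simp [hk, wallSign, δ.sign_self]
    · simp [hk]
  rw [Finset.prod_congr rfl fun k _ => h k, Finset.prod_mul_distrib, Finset.prod_ite_eq']
  have hw : ∏ k, wallSign δ i ε k = ε := by
    rcases Int.units_eq_one_or ε with rfl | rfl
    · simp [wallSign]
    · simpa [wallSign] using hprod
  have hw' : ∏ k, ((wallSign δ i ε k : ℤ) : ℝ) = ((ε : ℤ) : ℝ) := by
    conv_rhs => rw [← hw]
    push_cast
    rfl
  rw [hw', if_pos (Finset.mem_univ i), neg_one_mul]

end EdgeTransition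

section Nonorientability

variable {ι M N : Type*} [AddCommGroup M] [Module ℝ M] [NormedAddCommGroup N] [NormedSpace ℝ N]
  {P : RootPairing ι ℝ M N} {b : P.Base} {x₀ : N} [P.IsRootSystem] [P.IsCrystallographic]

/-! ### Nonorientability -/

open Topology Filter

variable [Finite ι]

omit [P.IsRootSystem] in
lemma edgeMidpoint_mem_edgeNhd (hx₀ : ∀ i : b.support, 0 < P.root' i x₀) (i : b.support)
    (ε : ℤˣ) : edgeMidpoint x₀ i ε ∈ edgeNhd b x₀ i := by
  classical
  have h := edgeMidpoint_self_sq (hx₀ i) ε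
  rw [edgeMidpoint_self] at h
  exact single_mem_edgeNhd hx₀ h.le

/-- At a midpoint of the edge, the parametrizations at `w` and `w s_i` induce orientations that
differ by the sign of the Jacobian determinant of the coordinate change. -/
lemma det_fderiv_edgeMidpoint {δ : MarkedDynkinDiagram b}
    (hx₀ : ∀ i : b.support, 0 < P.root' i x₀) {w : Weyl b} {i : b.support}
    (hprod : ∏ k, δ.sign i k = -1) {φ ψ : (b.support → ℝ) → Space δ x₀}
    (hφ : ∀ y ∈ edgeNhd b x₀ i, IsEdgeValue δ x₀ w i y (φ y))
    (hψ : ∀ y ∈ edgeNhd b x₀ i, IsEdgeValue δ x₀ (w * simpleReflection b i) i y (ψ y)) (ε : ℤˣ) :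
    φ (edgeMidpoint x₀ i ε) = ψ (edgeMidpoint x₀ i ε) ∧
    ∀ f : Space δ x₀ → b.support → ℝ, DifferentiableAt ℝ (f ∘ ψ) (edgeMidpoint x₀ i ε) →
      (fderiv ℝ (f ∘ φ) (edgeMidpoint x₀ i ε)).det =
        -((ε : ℤ) : ℝ) * (fderiv ℝ (f ∘ ψ) (edgeMidpoint x₀ i ε)).det := by
  have hmem := edgeMidpoint_mem_edgeNhd hx₀ i ε
  have hT := edgeTransition_edgeMidpoint δ (hx₀ i) ε
  have hdiff : DifferentiableAt ℝ (edgeTransition δ x₀ i ε) (edgeMidpoint x₀ i ε) :=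
    (hasFDerivAt_edgeTransition δ (hx₀ i) ε).differentiableAt
  have hnhds := (isOpen_edgeNhd (x₀ := x₀) i).mem_nhds hmem
  have hsign : 0 < ((ε : ℤ) : ℝ) * edgeMidpoint x₀ i ε i := by
    rw [edgeMidpoint_self, ← mul_assoc, units_cast_mul_self, one_mul]
    exact edgeRadius_pos (hx₀ i)
  have hsq : 0 < edgeMidpoint x₀ i ε i ^ 2 +
      P.root' i (boxVec b x₀ (edgeMidpoint x₀ i ε)) := by
    rw [root'_boxVec_edgeMidpoint (hx₀ i), add_zero, edgeMidpoint_self_sq (hx₀ i)]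
    exact half_pos (hx₀ i)
  have heq : φ =ᶠ[𝓝 (edgeMidpoint x₀ i ε)] ψ ∘ edgeTransition δ x₀ i ε := by
    have h1 : ∀ᶠ y in 𝓝 (edgeMidpoint x₀ i ε), edgeTransition δ x₀ i ε y ∈ edgeNhd b x₀ i :=
      hdiff.continuousAt.eventually_mem (by rw [hT]; exact hnhds)
    have h2 : ∀ᶠ y : b.support → ℝ in 𝓝 (edgeMidpoint x₀ i ε), 0 < ((ε : ℤ) : ℝ) * y i :=
      ((continuous_const.mul (continuous_apply i)).continuousAt).eventually_const_lt hsign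
    have h3 : ∀ᶠ y : b.support → ℝ in 𝓝 (edgeMidpoint x₀ i ε),
        0 < y i ^ 2 + P.root' i (boxVec b x₀ y) :=
      (((continuous_apply i).pow 2).add
        (continuous_root'_boxVec i)).continuousAt.eventually_const_lt hsq
    filter_upwards [hnhds, h1, h2, h3] with y hy hy1 hy2 hy3
    exact eq_comp_edgeTransition hx₀ hφ hψ hy hy1 hy2 hy3.le
  refine ⟨by simpa [hT] using heq.eq_of_nhds, fun f hf => ?_⟩
  have heq' : f ∘ φ =ᶠ[𝓝 (edgeMidpoint x₀ i ε)] (f ∘ ψ) ∘ edgeTransition δ x₀ i ε :=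
    heq.fun_comp f
  rw [heq'.fderiv_eq, fderiv_comp _ (by rwa [hT]) hdiff, hT, ContinuousLinearMap.det,
    ContinuousLinearMap.toLinearMap_comp, LinearMap.det_comp, mul_comm]
  congr 1
  exact det_fderiv_edgeTransition (hx₀ i) hprod ε

/-- The set `S` is the axis segment joining the two midpoints. It serves for both boxes, and `φ` and
`ψ` agree at its ends. -/
theorem not_isOrientable_of_prod_sign_eq_neg_one {δ : MarkedDynkinDiagram b}
    (hx₀ : ∀ i : b.support, 0 < P.root' i x₀) {i : b.support}
    (hprod : ∏ k, δ.sign i k = -1) : ¬ IsOrientable (smoothCharts δ x₀) := by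
  classical
  rintro ⟨A, hAS, hcov, hpos⟩
  have _n : Nonempty b.support := ⟨i⟩
  set U := edgeNhd b x₀ i
  set S : Set (b.support → ℝ) :=
    Pi.single i '' Set.Icc (-edgeRadius x₀ i) (edgeRadius x₀ i) with hSdef
  have hr := edgeRadius_pos (hx₀ i)
  have hS : IsPreconnected S := isPreconnected_Icc.image _
    (continuous_single (A := fun _ : b.support => ℝ) i).continuousOn
  have hSU : S ⊆ U := by
    rintro _ ⟨t, ht, rfl⟩
    refine single_mem_edgeNhd hx₀ ?_
    rw [← edgeRadius_sq (hx₀ i)]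
    exact sq_le_sq' ht.1 ht.2
  have hmid : ∀ ε, edgeMidpoint x₀ i ε ∈ S := by
    intro ε
    rw [hSdef, edgeMidpoint]
    refine ⟨_, ?_, by congr!⟩
    rcases Int.units_eq_one_or ε with rfl | rfl <;> simp [hr.le]
  have hopen : IsOpen U := isOpen_edgeNhd i
  have hparam : ∀ w : Weyl b, ∃ φ : (b.support → ℝ) → Space δ x₀,
      (∀ y ∈ U, IsEdgeValue δ x₀ w i y (φ y)) ∧ ContinuousOn φ U ∧
      (∀ e ∈ A, ContDiffOn ℝ ∞ (e ∘ φ) (U ∩ φ ⁻¹' e.source)) ∧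
      (∀ e ∈ A, ∀ y ∈ U ∩ φ ⁻¹' e.source, (fderiv ℝ (e ∘ φ) y).det ≠ 0) := by
    intro w
    obtain ⟨φ, hφ, hval⟩ := exists_edgeParametrization δ hx₀ w i
    have hsub := edgeNhd_subset_boxDomain hx₀ w i
    exact ⟨φ, hval, continuousOn_edgeParametrization δ hx₀ w i hval,
      fun e he => (hAS he w φ hφ).1.mono (Set.inter_subset_inter_left _ hsub),
      fun e he y hy => (hAS he w φ hφ).2 y ⟨hsub hy.1, hy.2⟩⟩
  obtain ⟨φ, hφ, hφc, hφs, hφd⟩ := hparam 1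
  obtain ⟨ψ, hψ, hψc, hψs, hψd⟩ := hparam (1 * simpleReflection b i)
  choose e he hsrc using fun ε => hcov (φ (edgeMidpoint x₀ i ε))
  have key := fun ε => det_fderiv_edgeMidpoint hx₀ hprod hφ hψ ε
  have hsrc' : ∀ ε, ψ (edgeMidpoint x₀ i ε) ∈ (e ε).source := fun ε => (key ε).1 ▸ hsrc ε
  have hdet := fun ε => (key ε).2 (e ε) (((hψs _ (he ε)).contDiffAt
    ((hψc.isOpen_inter_preimage hopen (e ε).open_source).mem_nhds
      ⟨hSU (hmid ε), hsrc' ε⟩)).differentiableAt (by simp))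
  have h1 := det_fderiv_mul_pos_of_isPreconnected hcov hpos hopen hφc hφs hφd hS hSU (hmid 1)
    (hmid (-1)) (he 1) (he (-1)) (hsrc 1) (hsrc (-1))
  have h2 := det_fderiv_mul_pos_of_isPreconnected hcov hpos hopen hψc hψs hψd hS hSU (hmid 1)
    (hmid (-1)) (he 1) (he (-1)) (hsrc' 1) (hsrc' (-1))
  -- Passing from `φ` to `ψ` flips the sign at the midpoint `1` and not at `-1`, so `h1` becomes the
  -- negation of the sign asserted by `h2`.
  rw [hdet 1, hdet (-1)] at h1
  simp only [Units.val_one, Units.val_neg, Int.cast_one, Int.cast_neg, neg_neg, one_mul] at h1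
  linarith

end Nonorientability

end TwistedTomei

end

theorem proposition4p3 {ι M N : Type*} [Finite ι] [AddCommGroup M] [Module ℝ M]
    [NormedAddCommGroup N] [NormedSpace ℝ N] (P : RootPairing ι ℝ M N) [P.IsRootSystem]
    [P.IsCrystallographic] [P.IsReduced] (b : P.Base)
    (x₀ : N) (hx₀ : ∀ i : b.support, 0 < P.root' i x₀)
    (δ : TwistedTomei.MarkedDynkinDiagram b) (hδ : ¬ δ.IsPositive) :
    ¬ TwistedTomei.IsOrientable (TwistedTomei.smoothCharts δ x₀) := by
  obtain ⟨i, hi⟩ := δ.exists_prod_sign_eq_neg_one hδ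
  exact TwistedTomei.not_isOrientable_of_prod_sign_eq_neg_one hx₀ hi
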